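/- **Proposition 3.6.** Let $\mathbb S^3$ be the $6$-dimensional space of complex symmetric $3\times3$ matrices, a matrix $M$ being identified with the quadratic form $v^TMv$, $v=(x,y,z)^T$. A net of conics is a $3$-dimensional linear subspace $\mathcal L\subset\mathbb S^3$. It is of type $D$, $F$, $F^*$ or $G^*$ if it equals $g^T\mathcal L_0\,g$ for some $g\in\mathrm{GL}_3(\mathbb C)$, where $\mathcal L_0$ is spanned by - $D$: $x^2,\ y^2,\ z^2+2xy$; - $F$: $x^2,\ y^2,\ 2xz+2yz$; - $F^*$: $x^2,\ 2xy,\ y^2+z^2$; - $G^*$: $x^2,\ 2xy,\ 2yz$. The reciprocal surface $\mathbb P\mathcal L^{-1}\subset\mathbb P(\mathbb S^3)=\mathbb P^5$ is the Zariski closure of $\{[A^{-1}] : A\in\mathcal L,\ \det A\ne0\}$, and the Veronese surface is $V=\{[tt^T] : 0\ne t\in\mathbb C^3\}\subset\mathbb P^5$. Let $\mathcal L$ be a net of type $D$, $F$, $F^*$ or $G^*$. Then $\mathbb P\mathcal L^{-1}$ has dimension $2$ and degree $2$, and it is a projection of the Veronese surface from a line. More precisely, for every basis $S_1,S_2,S_3$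 of $\mathcal L$ there is a linear map $T:\mathbb S^3\to\mathbb S^3$ with $T(tt^T)=\operatorname{adj}(t_1S_1+t_2S_2+t_3S_3)$ for all $t\in\mathbb C^3$, such that $\mathbb P\mathcal L^{-1}$ is the Zariski closure of $\{[T(M)] : [M]\in V,\ T(M)\neq0\}$ and the center of projection $\mathbb P(\ker T)$ is a line. For types $D$ and $F$ this line is a secant line of $V$, i.e. it is spanned by two distinct points of $V$. For types $F^*$ and $G^*$ it is a tangent line of $V$, i.e. it passes through a point of $V$ and lies in the embedded tangent plane of $V$ at that point. -/

import Mathlib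

noncomputable section

namespace NetsOfConics

open MvPolynomial

/-- The 6-dimensional space `𝕊³` of complex symmetric `3 × 3` matrices. A symmetric matrix `M` is
identified with the ternary quadratic form `vᵀ M v`, `v = (x, y, z)`. -/
def SymMat : Submodule ℂ (Matrix (Fin 3) (Fin 3) ℂ) where
  carrier := {M | M.IsSymm}
  add_mem' hA hB := Matrix.IsSymm.add hA hB
  zero_mem' := Matrix.isSymm_zero
  smul_mem' c _ hA := Matrix.IsSymm.smul hA c

/-- The projective space `ℙ⁵ = ℙ(𝕊³)`. -/
abbrev P5 : Type := Projectivization ℂ SymMat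

/-! ### Projective geometry in `ℙ⁵` -/

/-- The six homogeneous coordinates `u_{ij} = u_{ji}` of `ℙ⁵`: the entries of the matrix. -/
def coord (M : SymMat) : Sym2 (Fin 3) → ℂ :=
  Sym2.lift ⟨fun i j => M.1 i j, fun i j => Matrix.IsSymm.apply M.2 j i⟩

/-- The degree `d` part of the homogeneous vanishing ideal of `X ⊆ ℙ⁵`: the forms of degree `d` in
the `u_{ij}` that vanish at every point of `X`. -/
def vanishingForms (X : Set P5) (d : ℕ) :
    Submodule ℂ (homogeneousSubmodule (Sym2 (Fin 3)) ℂ d) where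
  carrier := {f | ∀ (M : SymMat) (hM : M ≠ 0), Projectivization.mk ℂ M hM ∈ X →
    eval (coord M) f.1 = 0}
  add_mem' hf hg M hM hX := by
    simp only [Submodule.coe_add, map_add, hf M hM hX, hg M hM hX, add_zero]
  zero_mem' M _ _ := by simp
  smul_mem' c f hf M hM hX := by
    simp only [Submodule.coe_smul, smul_eval, hf M hM hX, mul_zero]

/-- The Zariski closure of a subset of `ℙ⁵`: the points at which every form vanishes that vanishes
on the subset. -/
def zariskiClosure (X : Set P5) : Set P5 :=
  {p | ∀ d : ℕ, vanishingForms X d ≤ vanishingForms {p} d}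

/-- The Hilbert function of `X ⊆ ℙ⁵`: the dimension of the degree `d` part of the homogeneous
coordinate ring of `X`. -/
def hilbertFunction (X : Set P5) (d : ℕ) : ℕ :=
  Module.finrank ℂ (homogeneousSubmodule (Sym2 (Fin 3)) ℂ d ⧸ vanishingForms X d)

/-- `X ⊆ ℙ⁵` has dimension `n` and degree `e`: its Hilbert function agrees for all large arguments
with a polynomial of degree `n` and leading coefficient `e / n!`. -/
def HasDimensionAndDegree (X : Set P5) (n e : ℕ) : Prop :=
  ∃ P : Polynomial ℚ,
    (∀ᶠ d : ℕ in Filter.atTop, (hilbertFunction X d : ℚ) = P.eval (d : ℚ)) ∧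
    P.degree = n ∧ P.leadingCoeff * (n.factorial : ℚ) = e

/-- The cone over the embedded projective tangent space of `X ⊆ ℙ⁵` at the point represented by
`M`: the common kernel of the differentials at `M` of the forms vanishing on `X`. -/
def tangentSpace (X : Set P5) (M : SymMat) : Set SymMat :=
  {N | ∀ (d : ℕ), ∀ f ∈ vanishingForms X d,
    ∑ s : Sym2 (Fin 3), eval (coord M) (pderiv s f.1) * coord N s = 0}

/-- The line `ℙ(W)` is a secant line of `X`, spanned by two distinct points of `X`. -/
def IsSecantLine (X : Set P5) (W : Submodule ℂ SymMat) : Prop :=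
  ∃ p ∈ X, ∃ q ∈ X, p ≠ q ∧ W = p.submodule ⊔ q.submodule

/-- `ℙ(W)` is a line that is tangent to `X` at some point of `X`. -/
def IsTangentLine (X : Set P5) (W : Submodule ℂ SymMat) : Prop :=
  Module.finrank ℂ W = 2 ∧ ∃ (M : SymMat) (hM : M ≠ 0), Projectivization.mk ℂ M hM ∈ X ∧
    M ∈ W ∧ (W : Set SymMat) ⊆ tangentSpace X M

/-- The image of `X \ ℙ(ker T)` under the rational map `ℙ⁵ ⇢ ℙ⁵` induced by a linear map `T`,
that is, under the linear projection with center `ℙ(ker T)`, followed by the embedding of its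
target as the linear subspace `ℙ(range T)` of `ℙ⁵`. -/
def projectionImage (T : SymMat →ₗ[ℂ] SymMat) (X : Set P5) : Set P5 :=
  {q | ∃ (M : SymMat) (hM : M ≠ 0) (hT : T M ≠ 0),
    Projectivization.mk ℂ M hM ∈ X ∧ q = Projectivization.mk ℂ (T M) hT}

/-! ### The Veronese surface -/

/-- The symmetric matrix `t tᵀ`. -/
def veronese (t : Fin 3 → ℂ) : SymMat :=
  ⟨Matrix.vecMulVec t t, by
    ext i j
    simp [Matrix.vecMulVec_apply, mul_comm]⟩

/-- The Veronese surface in `ℙ⁵`. -/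
def veroneseSurface : Set P5 :=
  {p | ∃ (t : Fin 3 → ℂ) (ht : veronese t ≠ 0), p = Projectivization.mk ℂ (veronese t) ht}

/-! ### Nets of conics and reciprocal surfaces -/

/-- The inverse of a symmetric matrix. -/
def symInv (A : SymMat) : SymMat :=
  ⟨A.1⁻¹, by
    have h : A.1.transpose = A.1 := A.2
    change (A.1⁻¹).transpose = A.1⁻¹
    rw [Matrix.transpose_nonsing_inv, h]⟩

/-- The adjugate of a symmetric matrix. -/
def symAdj (A : SymMat) : SymMat :=
  ⟨A.1.adjugate, by
    have h : A.1.transpose = A.1 := A.2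
    change (A.1.adjugate).transpose = A.1.adjugate
    rw [Matrix.adjugate_transpose, h]⟩

/-- The reciprocal surface `ℙL⁻¹`: the Zariski closure in `ℙ⁵` of the set of inverses of the
invertible matrices in `L`. -/
def reciprocalSurface (L : Submodule ℂ SymMat) : Set P5 :=
  zariskiClosure {p | ∃ A ∈ L, A.1.det ≠ 0 ∧
    ∃ h : symInv A ≠ 0, p = Projectivization.mk ℂ (symInv A) h}

/-- The congruence action `M ↦ gᵀ M g` of `GL(3)` on symmetric matrices. -/
def congruence (g : Matrix.GeneralLinearGroup (Fin 3) ℂ) : SymMat →ₗ[ℂ] SymMat where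
  toFun M := ⟨g.1.transpose * M.1 * g.1, by
    have h : M.1.transpose = M.1 := M.2
    change (g.1.transpose * M.1 * g.1).transpose = g.1.transpose * M.1 * g.1
    simp only [Matrix.transpose_mul, Matrix.transpose_transpose, h, Matrix.mul_assoc]⟩
  map_add' M N := by
    apply Subtype.ext
    simp [Matrix.mul_add, Matrix.add_mul]
  map_smul' c M := by
    apply Subtype.ext
    simp

/-- Wall's types `D`, `F`, `F*`, `G*` of nets of conics. -/
inductive NetType
  | D
  | F
  | Fstar
  | Gstar

/-- The symmetric matrix of the quadratic form
`a x² + b y² + c z² + 2 p x y + 2 q x z + 2 r y z`. -/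
def form (a b c p q r : ℂ) : SymMat :=
  ⟨!![a, p, q; p, b, r; q, r, c], by
    ext i j
    fin_cases i <;> fin_cases j <;> rfl⟩

/-- Generators of the standard net of each type. -/
def generators : NetType → Fin 3 → SymMat
  -- `x², y², z² + 2xy`
  | .D => ![form 1 0 0 0 0 0, form 0 1 0 0 0 0, form 0 0 1 1 0 0]
  -- `x², y², 2xz + 2yz`
  | .F => ![form 1 0 0 0 0 0, form 0 1 0 0 0 0, form 0 0 0 0 1 1]
  -- `x², 2xy, y² + z²`
  | .Fstar => ![form 1 0 0 0 0 0, form 0 0 0 1 0 0, form 0 1 1 0 0 0]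
  -- `x², 2xy, 2yz`
  | .Gstar => ![form 1 0 0 0 0 0, form 0 0 0 1 0 0, form 0 0 0 0 0 1]

/-- The net `L` is of type `τ`: it lies in the congruence orbit of the standard net of type `τ`. -/
def IsOfType (L : Submodule ℂ SymMat) (τ : NetType) : Prop :=
  ∃ g : Matrix.GeneralLinearGroup (Fin 3) ℂ,
    L = (Submodule.span ℂ (Set.range (generators τ))).map (congruence g)

end NetsOfConics

end

noncomputable section

namespace NetsOfConics

open MvPolynomial

/-! The inverse of an invertible matrix is its adjugate up to scale, and the adjugate of `∑ tᵢ Sᵢ`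
is quadratic in `t`, hence a linear function `T` of `t tᵀ`. So the inverses and the projected
Veronese surface are both parametrized by this adjugate wherever the determinant is nonzero; by
`mem_vanishingForms_iff_of_parametrization` the same forms vanish on them, and their closures agree.

For the standard nets only four of the six quadratic monomials in `t` occur, with linearly
independent coefficient matrices (`symAdj_sum_generators`, `linearIndependent_adjCoeff`). Hence `ker
T` consists of the symmetric matrices supported on the other two positions: `x², y²` for `D`, `F` (a
secant), `x², xy` for `F*`, `G*` (a tangent). The coordinate ring is generated by the four
monomials, and its degree `d` part has dimension `(d + 1)²`, which gives dimension and degree 2.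

A congruence of the net induces a congruence on adjugates, and a change of basis induces one on the
`t tᵀ`; both are invertible and preserve the Veronese surface, so the standard case suffices. -/

theorem eval_smul_of_isHomogeneous {σ R : Type*} [CommSemiring R] {f : MvPolynomial σ R} {d : ℕ}
    (hf : f.IsHomogeneous d) (c : R) (x : σ → R) :
    eval (c • x) f = c ^ d * eval x f := by
  classical
  rw [eval_eq, eval_eq, Finset.mul_sum]
  refine Finset.sum_congr rfl fun e he => ?_
  have hd : ∑ i ∈ e.support, e i = d := by
    have := hf (mem_support_iff.1 he)
    rwa [Finsupp.weight_apply, Finsupp.sum, Finset.sum_congr rfl (fun _ _ => by simp; rfl)] at this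
  simp only [Pi.smul_apply, smul_eq_mul, mul_pow, Finset.prod_mul_distrib,
    Finset.prod_pow_eq_pow_sum, hd]
  ring

theorem eval_aeval {σ τ R : Type*} [CommSemiring R] (q : σ → MvPolynomial τ R)
    (f : MvPolynomial σ R) (t : τ → R) :
    eval t (aeval q f) = eval (fun s => eval t (q s)) f := by
  rw [aeval_eq_bind₁, ← coe_aeval_eq_eval, ← coe_aeval_eq_eval]
  exact aeval_bind₁ _ _ _

theorem coord_smul (c : ℂ) (M : SymMat) : coord (c • M) = c • coord M := by
  funext s
  induction s with | _ i j => rfl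

theorem coord_add (M N : SymMat) : coord (M + N) = coord M + coord N := by
  funext s
  induction s with | _ i j => rfl

/-- The homogeneous coordinates as a linear map. -/
def coordLinear : SymMat →ₗ[ℂ] (Sym2 (Fin 3) → ℂ) where
  toFun := coord
  map_add' := coord_add
  map_smul' := coord_smul

theorem coordLinear_injective : Function.Injective coordLinear := by
  intro M N h
  apply Subtype.ext
  ext i j
  exact congrFun h s(i, j)

/-! ### Vanishing forms of parametrized sets -/

/-- The forms vanishing on a set that contains a nonempty open part of a parametrized variety and
is contained in that variety are those that vanish after substitution of the parametrization. -/
theorem mem_vanishingForms_iff_of_parametrization {F : (Fin 3 → ℂ) → SymMat}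
    {q : Sym2 (Fin 3) → MvPolynomial (Fin 3) ℂ} (hq : ∀ t s, eval t (q s) = coord (F t) s)
    {h : MvPolynomial (Fin 3) ℂ} (h0 : h ≠ 0) {X : Set P5}
    (hX : ∀ p ∈ X, ∃ t, ∃ hF : F t ≠ 0, p = Projectivization.mk ℂ (F t) hF)
    (hX' : ∀ t, eval t h ≠ 0 → ∃ hF : F t ≠ 0, Projectivization.mk ℂ (F t) hF ∈ X)
    {d : ℕ} (f : homogeneousSubmodule (Sym2 (Fin 3)) ℂ d) :
    f ∈ vanishingForms X d ↔ aeval q f.1 = 0 := by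
  have key : ∀ t, eval t (aeval q f.1) = eval (coord (F t)) f.1 := fun t => by
    rw [eval_aeval, funext (hq t)]
  constructor
  · intro hf
    -- The factor `h` covers the parameters whose image is not known to lie in `X`; it cancels since
    -- the polynomial ring is a domain.
    have hz : h * aeval q f.1 = 0 := by
      apply MvPolynomial.funext
      intro t
      rw [map_mul, map_zero, key]
      by_cases ht : eval t h = 0
      · rw [ht, zero_mul]
      · obtain ⟨hF, hmem⟩ := hX' t ht
        rw [hf _ hF hmem, mul_zero]
    exact (mul_eq_zero.1 hz).resolve_left h0
  · intro hf M hM hMX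
    obtain ⟨t, hF, hp⟩ := hX _ hMX
    obtain ⟨c, hc⟩ := (Projectivization.mk_eq_mk_iff' ℂ _ _ hM hF).1 hp
    rw [← hc, coord_smul, eval_smul_of_isHomogeneous ((mem_homogeneousSubmodule _ _).1 f.2),
      ← key, hf, map_zero, mul_zero]

theorem zariskiClosure_congr {X Y : Set P5} (h : ∀ d, vanishingForms X d = vanishingForms Y d) :
    zariskiClosure X = zariskiClosure Y := by
  simp only [zariskiClosure, h]

theorem vanishingForms_zariskiClosure (X : Set P5) (d : ℕ) :
    vanishingForms (zariskiClosure X) d = vanishingForms X d := by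
  apply le_antisymm
  · intro f hf M hM hX
    refine hf M hM fun e g hg N hN hNX => ?_
    rw [Set.mem_singleton_iff] at hNX
    exact hg N hN (hNX ▸ hX)
  · intro f hf M hM hX
    exact hX d hf M hM rfl

theorem derivation_aeval {σ τ R : Type*} [Fintype σ] [CommSemiring R]
    (D : Derivation R (MvPolynomial τ R) (MvPolynomial τ R)) (q : σ → MvPolynomial τ R)
    (f : MvPolynomial σ R) :
    D (aeval q f) = ∑ s, aeval q (pderiv s f) * D (q s) := by
  classical
  induction f using MvPolynomial.induction_on with
  | C a => simp
  | add p r hp hr => simp only [map_add, hp, hr, add_mul, Finset.sum_add_distrib]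
  | mul_X p s hp =>
    simp only [map_mul, aeval_X, Derivation.leibniz, smul_eq_mul, hp, pderiv_X, map_add, add_mul,
      Finset.sum_add_distrib, Finset.mul_sum, Pi.single_apply]
    congr 1
    · rw [Finset.sum_eq_single s]
      · simp
      · intro b _ hb; simp [hb.symm]
      · simp
    · exact Finset.sum_congr rfl fun _ _ => by ring

/-! ### The Veronese surface and its tangent planes -/

/-- The coordinates of the Veronese map. -/
def veroneseCoord : Sym2 (Fin 3) → MvPolynomial (Fin 3) ℂ :=
  Sym2.lift ⟨fun i j => X i * X j, fun _ _ => mul_comm _ _⟩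

theorem eval_veroneseCoord (t : Fin 3 → ℂ) (s : Sym2 (Fin 3)) :
    eval t (veroneseCoord s) = coord (veronese t) s := by
  induction s with | _ i j => simp [veroneseCoord, coord, veronese, Matrix.vecMulVec_apply]

theorem veronese_ne_zero {t : Fin 3 → ℂ} (ht : t ≠ 0) : veronese t ≠ 0 := by
  intro h
  obtain ⟨i, hi⟩ := Function.ne_iff.1 ht
  have := congrFun (congrFun (congrArg Subtype.val h) i) i
  simp [veronese, Matrix.vecMulVec_apply] at this
  exact hi this

theorem mem_vanishingForms_veroneseSurface {d : ℕ}
    (f : homogeneousSubmodule (Sym2 (Fin 3)) ℂ d) :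
    f ∈ vanishingForms veroneseSurface d ↔ aeval veroneseCoord f.1 = 0 := by
  refine mem_vanishingForms_iff_of_parametrization eval_veroneseCoord (X_ne_zero (0 : Fin 3))
    (fun p hp => hp) (fun t ht => ?_) f
  have h0 : t ≠ 0 := by
    rintro rfl
    simp at ht
  exact ⟨veronese_ne_zero h0, t, veronese_ne_zero h0, rfl⟩

/-- The polarization `u vᵀ + v uᵀ` of the Veronese map. -/
def symPair (u v : Fin 3 → ℂ) : SymMat := veronese (u + v) - veronese u - veronese v

theorem symPair_apply (u v : Fin 3 → ℂ) (i j : Fin 3) :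
    (symPair u v).1 i j = u i * v j + v i * u j := by
  simp [symPair, veronese, Matrix.vecMulVec_apply]
  ring

/-- A form `f` vanishing on the surface satisfies `f(t tᵀ) = 0` identically in `t`. Differentiating
at `u` in direction `v` by the chain rule `derivation_aeval` gives the claim. -/
theorem symPair_mem_tangentSpace (u v : Fin 3 → ℂ) :
    symPair u v ∈ tangentSpace veroneseSurface (veronese u) := by
  intro d f hf
  rw [mem_vanishingForms_veroneseSurface] at hf
  have h := derivation_aeval (mkDerivation ℂ fun i => C (v i)) veroneseCoord f.1
  rw [hf, map_zero] at h
  have h2 := congrArg (eval u) h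
  rw [map_zero, map_sum] at h2
  rw [h2]
  refine Finset.sum_congr rfl fun s _ => ?_
  rw [map_mul, eval_aeval, funext (eval_veroneseCoord u)]
  congr 1
  induction s with
  | _ i j =>
    simp only [veroneseCoord, Sym2.lift_mk, Derivation.leibniz, mkDerivation_X, smul_eq_mul,
      map_add, map_mul, eval_X, eval_C]
    change (symPair u v).1 i j = _
    rw [symPair_apply]
    ring

/-! ### Hilbert functions as dimensions of spans of monomials -/

/-- If the forms of degree `d` vanishing on `X` are those that vanish after substitution of `q`,
then the Hilbert function of `X` is that of the algebra generated by `q`. -/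
theorem hilbertFunction_eq_finrank_span_pow {X : Set P5} {d : ℕ}
    {q : Sym2 (Fin 3) → MvPolynomial (Fin 3) ℂ}
    (h : ∀ f : homogeneousSubmodule (Sym2 (Fin 3)) ℂ d, f ∈ vanishingForms X d ↔ aeval q f.1 = 0) :
    hilbertFunction X d = Module.finrank ℂ ↥(Submodule.span ℂ (Set.range q) ^ d) := by
  let φ := (aeval (R := ℂ) q).toLinearMap ∘ₗ (homogeneousSubmodule (Sym2 (Fin 3)) ℂ d).subtype
  have hker : vanishingForms X d = LinearMap.ker φ := by
    ext f
    rw [h, LinearMap.mem_ker]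
    rfl
  have hrange : LinearMap.range φ = Submodule.span ℂ (Set.range q) ^ d := by
    rw [LinearMap.range_comp, Submodule.range_subtype, ← homogeneousSubmodule_one_pow,
      Submodule.map_pow, homogeneousSubmodule_one_eq_span_X, Submodule.map_span, ← Set.range_comp]
    congr 3
    funext s
    simp
  rw [hilbertFunction, hker, φ.quotKerEquivRange.finrank_eq, hrange]

/-- The span of the coordinates of a parametrization `∑ k, m k • N k` with linearly independent `N`
is the span of the functions `m k`. -/
theorem span_coord_eq_span {κ : Type*} [Fintype κ] {N : κ → SymMat}
    (hN : LinearIndependent ℂ N) (m : κ → MvPolynomial (Fin 3) ℂ) :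
    Submodule.span ℂ (Set.range fun s => ∑ k, coord (N k) s • m k) =
      Submodule.span ℂ (Set.range m) := by
  classical
  apply le_antisymm
  · rw [Submodule.span_le]
    rintro _ ⟨s, rfl⟩
    exact Submodule.sum_mem _ fun k _ =>
      Submodule.smul_mem _ _ (Submodule.subset_span (Set.mem_range_self k))
  · rw [Submodule.span_le]
    rintro _ ⟨k, rfl⟩
    have hli : LinearIndependent ℂ (coordLinear ∘ N) :=
      hN.map' _ (LinearMap.ker_eq_bot.2 coordLinear_injective)
    -- `g` is a functional dual to `N k` that kills the other `N j`. Applied to the coordinates of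
    -- the parametrization, it isolates `m k`.
    obtain ⟨g, hg⟩ := LinearMap.exists_extend
      ((Finsupp.lapply k : (κ →₀ ℂ) →ₗ[ℂ] ℂ) ∘ₗ hli.repr)
    have hgN : ∀ j, g (coord (N j)) = if j = k then 1 else 0 := by
      intro j
      have h1 := LinearMap.congr_fun hg
        ⟨coord (N j), Submodule.subset_span (Set.mem_range_self (f := coordLinear ∘ N) j)⟩
      have h2 := hli.repr_eq_single j
        ⟨coord (N j), Submodule.subset_span (Set.mem_range_self (f := coordLinear ∘ N) j)⟩ rfl
      simp only [LinearMap.comp_apply, Submodule.subtype_apply] at h1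
      rw [h1]
      change (hli.repr _) k = _
      rw [h2, Finsupp.single_apply]
    have hm : m k = ∑ s, g (Pi.single s 1) • ∑ j, coord (N j) s • m j := by
      have h3 : ∀ j, g (coord (N j)) = ∑ s, g (Pi.single s 1) * coord (N j) s := by
        intro j
        rw [LinearMap.pi_apply_eq_sum_univ g]
        refine Finset.sum_congr rfl fun s _ => ?_
        rw [smul_eq_mul, mul_comm]
        congr 2
        funext r
        simp [Pi.single_apply, eq_comm]
      simp only [Finset.smul_sum, smul_smul]
      rw [Finset.sum_comm]
      simp only [← Finset.sum_smul, ← h3, hgN]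
      simp
    change m k ∈ _
    rw [hm]
    exact Submodule.sum_mem _ fun s _ =>
      Submodule.smul_mem _ _ (Submodule.subset_span ⟨s, rfl⟩)

/-- A power of the span of monomials is spanned by the monomials with exponents in an iterated
sumset. -/
theorem span_monomial_pow {σ κ : Type*} (e : κ → (σ →₀ ℕ)) (S : ℕ → Set (σ →₀ ℕ))
    (h0 : S 0 = {0}) (hS : ∀ d, ∀ x, x ∈ S (d + 1) ↔ ∃ y ∈ S d, ∃ k, x = y + e k) (d : ℕ) :
    Submodule.span ℂ (Set.range fun k => monomial (e k) (1 : ℂ)) ^ d =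
      Submodule.span ℂ ((fun x => monomial x (1 : ℂ)) '' S d) := by
  induction d with
  | zero =>
    rw [pow_zero, h0, Set.image_singleton, Submodule.one_eq_span]
    rfl
  | succ d ih =>
    rw [pow_succ, ih, Submodule.span_mul_span]
    congr 1
    ext p
    simp only [Set.mem_mul, Set.mem_image, Set.mem_range]
    constructor
    · rintro ⟨_, ⟨y, hy, rfl⟩, _, ⟨k, rfl⟩, rfl⟩
      exact ⟨y + e k, (hS d _).2 ⟨y, hy, k, rfl⟩, by rw [monomial_mul, one_mul]⟩
    · rintro ⟨x, hx, rfl⟩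
      obtain ⟨y, hy, k, rfl⟩ := (hS d _).1 hx
      exact ⟨_, ⟨y, hy, rfl⟩, _, ⟨k, rfl⟩, by rw [monomial_mul, one_mul]⟩

theorem finrank_span_monomial {σ ι : Type*} [Fintype ι] (e : ι → (σ →₀ ℕ))
    (he : Function.Injective e) {S : Set (σ →₀ ℕ)} (hS : Set.range e = S) :
    Module.finrank ℂ ↥(Submodule.span ℂ ((fun x => monomial x (1 : ℂ)) '' S)) =
      Fintype.card ι := by
  rw [← hS, ← Set.range_comp]
  apply finrank_span_eq_card
  have := (basisMonomials σ ℂ).linearIndependent.comp e he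
  rwa [coe_basisMonomials] at this

/-- The positions of the entries of `t tᵀ` on which the adjugate of the net of a given type
depends. -/
def entries : NetType → Fin 4 → Fin 3 × Fin 3
  | .D | .F => ![(1, 2), (2, 2), (0, 2), (0, 1)]
  | .Fstar | .Gstar => ![(2, 2), (1, 2), (0, 2), (1, 1)]

/-- The quadratic monomials at the positions `entries τ`. -/
def quadric (τ : NetType) (k : Fin 4) : MvPolynomial (Fin 3) ℂ :=
  X (entries τ k).1 * X (entries τ k).2

/-- The exponent vector with entries `a`, `b`, `c`. -/
def expo (a b c : ℕ) : Fin 3 →₀ ℕ := Finsupp.equivFunOnFinite.symm ![a, b, c]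

theorem expo_inj {a b c a' b' c' : ℕ} :
    expo a b c = expo a' b' c' ↔ a = a' ∧ b = b' ∧ c = c' := by
  simp [expo]

theorem expo_add (a b c a' b' c' : ℕ) :
    expo a b c + expo a' b' c' = expo (a + a') (b + b') (c + c') := by
  ext i
  fin_cases i <;> rfl

theorem expo_zero : expo 0 0 0 = 0 := by
  ext i
  fin_cases i <;> rfl

theorem exists_expo (x : Fin 3 →₀ ℕ) : ∃ a b c, x = expo a b c :=
  ⟨x 0, x 1, x 2, by ext i; fin_cases i <;> rfl⟩

theorem monomial_expo (a b c : ℕ) :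
    monomial (expo a b c) (1 : ℂ) = X 0 ^ a * X 1 ^ b * X 2 ^ c := by
  rw [monomial_eq, Finsupp.prod_fintype _ _ (fun _ => pow_zero _), Fin.prod_univ_three]
  simp [expo]

/-- In each of `yz, z², xz, xy` the exponents of `x` and `y` are at most 1. Products of `d` of them
are exactly the monomials of degree `2d` with both exponents at most `d`, and these two exponents
can be chosen freely. -/
theorem finrank_span_quadric_pow_of_secant (d : ℕ) :
    Module.finrank ℂ ↥(Submodule.span ℂ (Set.range (quadric .D)) ^ d) = (d + 1) ^ 2 := by
  have hq : quadric .D = fun k =>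
      monomial ((![expo 0 1 1, expo 0 0 2, expo 1 0 1, expo 1 1 0] : Fin 4 → _) k) (1 : ℂ) := by
    funext k
    fin_cases k <;> simp [quadric, entries, monomial_expo, sq]
  rw [hq, span_monomial_pow _ (fun d => {x | x 0 ≤ d ∧ x 1 ≤ d ∧ x 0 + x 1 + x 2 = 2 * d})]
  · rw [finrank_span_monomial (ι := Fin (d + 1) × Fin (d + 1))
      (fun p => expo p.1 p.2 (2 * d - p.1 - p.2))]
    · simp [sq]
    · rintro ⟨a, b⟩ ⟨a', b'⟩ h
      obtain ⟨h1, h2, -⟩ := expo_inj.1 h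
      exact Prod.ext (Fin.ext h1) (Fin.ext h2)
    · ext x
      obtain ⟨a, b, c, rfl⟩ := exists_expo x
      simp only [Set.mem_range, expo_inj, Prod.exists, Set.mem_ofPred_eq]
      change _ ↔ a ≤ d ∧ b ≤ d ∧ a + b + c = 2 * d
      constructor
      · rintro ⟨⟨a', _⟩, ⟨b', _⟩, h1, h2, h3⟩
        simp only at h1 h2 h3
        omega
      · rintro ⟨h1, h2, h3⟩
        exact ⟨⟨a, by omega⟩, ⟨b, by omega⟩, rfl, rfl, by simp only; omega⟩
  · ext x
    obtain ⟨a, b, c, rfl⟩ := exists_expo x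
    change (a ≤ 0 ∧ b ≤ 0 ∧ a + b + c = 2 * 0) ↔ expo a b c ∈ ({0} : Set _)
    rw [Set.mem_singleton_iff, ← expo_zero, expo_inj]
    omega
  · intro d x
    obtain ⟨a, b, c, rfl⟩ := exists_expo x
    change (a ≤ d + 1 ∧ b ≤ d + 1 ∧ a + b + c = 2 * (d + 1)) ↔ _
    constructor
    · rintro ⟨h1, h2, h3⟩
      obtain ⟨k, a', b', c', h, h'⟩ : ∃ (k : Fin 4) (a' b' c' : ℕ),
          (a' ≤ d ∧ b' ≤ d ∧ a' + b' + c' = 2 * d) ∧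
          expo a b c = expo a' b' c' +
            (![expo 0 1 1, expo 0 0 2, expo 1 0 1, expo 1 1 0] : Fin 4 → _) k := by
        -- An exponent equal to `d + 1` forces a factor containing that variable. If neither is,
        -- then `c ≥ 2` and `z²` splits off.
        by_cases ha : a ≤ d <;> by_cases hb : b ≤ d
        · exact ⟨1, a, b, c - 2, by omega,
            ((expo_inj.2 (by omega)).trans (expo_add _ _ _ _ _ _).symm)⟩
        · exact ⟨0, a, b - 1, c - 1, by omega,
            ((expo_inj.2 (by omega)).trans (expo_add _ _ _ _ _ _).symm)⟩
        · exact ⟨2, a - 1, b, c - 1, by omega,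
            ((expo_inj.2 (by omega)).trans (expo_add _ _ _ _ _ _).symm)⟩
        · exact ⟨3, a - 1, b - 1, c, by omega,
            ((expo_inj.2 (by omega)).trans (expo_add _ _ _ _ _ _).symm)⟩
      exact ⟨expo a' b' c', h, k, h'⟩
    · rintro ⟨y, hy, k, h⟩
      obtain ⟨a', b', c', rfl⟩ := exists_expo y
      change a' ≤ d ∧ b' ≤ d ∧ a' + b' + c' = 2 * d at hy
      fin_cases k <;> have := expo_inj.1 (h.trans (expo_add _ _ _ _ _ _)) <;> omega

/-- In each of `z², yz, xz, y²` the exponent of `x` is at most that of `z`, and this inequality in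
degree `2d` characterizes the products of `d` of them. -/
theorem finrank_span_quadric_pow_of_tangent (d : ℕ) :
    Module.finrank ℂ ↥(Submodule.span ℂ (Set.range (quadric .Fstar)) ^ d) = (d + 1) ^ 2 := by
  have hq : quadric .Fstar = fun k =>
      monomial ((![expo 0 0 2, expo 0 1 1, expo 1 0 1, expo 0 2 0] : Fin 4 → _) k) (1 : ℂ) := by
    funext k
    fin_cases k <;> simp [quadric, entries, monomial_expo, sq]
  rw [hq, span_monomial_pow _ (fun d => {x | x 0 ≤ x 2 ∧ x 0 + x 1 + x 2 = 2 * d})]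
  -- With `x`-exponent `d - j`, the inequality allows the `y`-exponents `0, …, 2j`; the odd numbers
  -- `2j + 1` sum to `(d + 1)²`.
  · rw [finrank_span_monomial (ι := Σ j : Fin (d + 1), Fin (2 * (j : ℕ) + 1))
      (fun p => expo (d - p.1) p.2 (d + p.1 - p.2))]
    · rw [Fintype.card_sigma]
      simp only [Fintype.card_fin]
      rw [Fin.sum_univ_eq_sum_range (fun j => 2 * j + 1)]
      induction d with
      | zero => rfl
      | succ d ih => rw [Finset.sum_range_succ, ih]; ring
    · rintro ⟨⟨a, ha⟩, ⟨b, hb⟩⟩ ⟨⟨a', ha'⟩, ⟨b', hb'⟩⟩ h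
      have h := expo_inj.1 h
      simp only at h
      obtain rfl : a = a' := by omega
      obtain rfl : b = b' := by omega
      rfl
    · ext x
      obtain ⟨a, b, c, rfl⟩ := exists_expo x
      simp only [Set.mem_range, expo_inj, Sigma.exists, Set.mem_ofPred_eq]
      change _ ↔ a ≤ c ∧ a + b + c = 2 * d
      constructor
      · rintro ⟨⟨a', _⟩, ⟨b', hb'⟩, h1, h2, h3⟩
        simp only at h1 h2 h3 hb'
        omega
      · rintro ⟨h1, h3⟩
        exact ⟨⟨d - a, by omega⟩, ⟨b, by simp only; omega⟩, by simp only; omega, rfl,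
          by simp only; omega⟩
  · ext x
    obtain ⟨a, b, c, rfl⟩ := exists_expo x
    change (a ≤ c ∧ a + b + c = 2 * 0) ↔ expo a b c ∈ ({0} : Set _)
    rw [Set.mem_singleton_iff, ← expo_zero, expo_inj]
    omega
  · intro d x
    obtain ⟨a, b, c, rfl⟩ := exists_expo x
    change (a ≤ c ∧ a + b + c = 2 * (d + 1)) ↔ _
    constructor
    · rintro ⟨h1, h3⟩
      obtain ⟨k, a', b', c', h, h'⟩ : ∃ (k : Fin 4) (a' b' c' : ℕ),
          (a' ≤ c' ∧ a' + b' + c' = 2 * d) ∧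
          expo a b c = expo a' b' c' +
            (![expo 0 0 2, expo 0 1 1, expo 1 0 1, expo 0 2 0] : Fin 4 → _) k := by
        -- A factor `x` must come with a `z`, so `xz` splits off. Without `x` the inequality is void
        -- and only the parity of the `y`-exponent matters.
        by_cases ha : a = 0
        · by_cases hb : b = 0
          · exact ⟨0, a, b, c - 2, by omega,
            ((expo_inj.2 (by omega)).trans (expo_add _ _ _ _ _ _).symm)⟩
          by_cases hb1 : b = 1
          · exact ⟨1, a, b - 1, c - 1, by omega,
            ((expo_inj.2 (by omega)).trans (expo_add _ _ _ _ _ _).symm)⟩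
          · exact ⟨3, a, b - 2, c, by omega,
            ((expo_inj.2 (by omega)).trans (expo_add _ _ _ _ _ _).symm)⟩
        · exact ⟨2, a - 1, b, c - 1, by omega,
            ((expo_inj.2 (by omega)).trans (expo_add _ _ _ _ _ _).symm)⟩
      exact ⟨expo a' b' c', h, k, h'⟩
    · rintro ⟨y, hy, k, h⟩
      obtain ⟨a', b', c', rfl⟩ := exists_expo y
      change a' ≤ c' ∧ a' + b' + c' = 2 * d at hy
      fin_cases k <;> have := expo_inj.1 (h.trans (expo_add _ _ _ _ _ _)) <;> omega

theorem finrank_span_quadric_pow (τ : NetType) (d : ℕ) :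
    Module.finrank ℂ ↥(Submodule.span ℂ (Set.range (quadric τ)) ^ d) = (d + 1) ^ 2 := by
  cases τ
  · exact finrank_span_quadric_pow_of_secant d
  · exact finrank_span_quadric_pow_of_secant d
  · exact finrank_span_quadric_pow_of_tangent d
  · exact finrank_span_quadric_pow_of_tangent d

theorem hasDimensionAndDegree_of_hilbertFunction {X : Set P5}
    (h : ∀ d, hilbertFunction X d = (d + 1) ^ 2) : HasDimensionAndDegree X 2 2 := by
  have hm : ((Polynomial.X + Polynomial.C 1 : Polynomial ℚ)).Monic := Polynomial.monic_X_add_C 1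
  refine ⟨(Polynomial.X + Polynomial.C 1) ^ 2, Filter.Eventually.of_forall fun d => ?_, ?_, ?_⟩
  · rw [h]
    simp
  · rw [Polynomial.degree_pow, Polynomial.degree_X_add_C]
    rfl
  · rw [(hm.pow 2).leadingCoeff]
    norm_num [Nat.factorial]

/-! ### The congruence action -/

theorem congruence_mul_apply (g h : Matrix.GeneralLinearGroup (Fin 3) ℂ) (M : SymMat) :
    congruence g (congruence h M) = congruence (h * g) M := by
  apply Subtype.ext
  simp [congruence, Matrix.mul_assoc]

theorem congruence_one_apply (M : SymMat) : congruence 1 M = M := by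
  apply Subtype.ext
  simp [congruence]

/-- The congruence action as a linear equivalence. -/
def congruenceEquiv (g : Matrix.GeneralLinearGroup (Fin 3) ℂ) : SymMat ≃ₗ[ℂ] SymMat :=
  LinearEquiv.ofLinearMap (congruence g) (congruence g⁻¹)
    (by ext1 M; simp [congruence_mul_apply, congruence_one_apply])
    (by ext1 M; simp [congruence_mul_apply, congruence_one_apply])

theorem congruence_injective (g : Matrix.GeneralLinearGroup (Fin 3) ℂ) :
    Function.Injective (congruence g) :=
  (congruenceEquiv g).injective

theorem congruence_veronese (g : Matrix.GeneralLinearGroup (Fin 3) ℂ) (t : Fin 3 → ℂ) :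
    congruence g (veronese t) = veronese (g.1.transpose.mulVec t) := by
  apply Subtype.ext
  change g.1.transpose * Matrix.vecMulVec t t * g.1 = Matrix.vecMulVec _ _
  rw [Matrix.mul_vecMulVec, Matrix.vecMulVec_mul, Matrix.mulVec_transpose]

theorem congruence_symPair (g : Matrix.GeneralLinearGroup (Fin 3) ℂ) (u v : Fin 3 → ℂ) :
    congruence g (symPair u v) =
      symPair (g.1.transpose.mulVec u) (g.1.transpose.mulVec v) := by
  simp only [symPair, map_sub, congruence_veronese, Matrix.mulVec_add]

/-- The adjugate reverses products, so `G = adj(gᵀ)` works. -/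
theorem exists_symAdj_congruence (g : Matrix.GeneralLinearGroup (Fin 3) ℂ) :
    ∃ G : Matrix.GeneralLinearGroup (Fin 3) ℂ,
      ∀ A, symAdj (congruence g A) = congruence G (symAdj A) := by
  have hg : IsUnit g.1.det := (Matrix.isUnit_iff_isUnit_det _).1 g.isUnit
  refine ⟨Matrix.GeneralLinearGroup.mk'' g.1.transpose.adjugate ?_, fun A => ?_⟩
  · rw [Matrix.det_adjugate, Matrix.det_transpose]
    exact hg.pow _
  · apply Subtype.ext
    change (g.1.transpose * A.1 * g.1).adjugate =
      (g.1.transpose.adjugate).transpose * A.1.adjugate * g.1.transpose.adjugate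
    rw [Matrix.adjugate_mul_distrib, Matrix.adjugate_mul_distrib, Matrix.adjugate_transpose,
      Matrix.transpose_transpose, Matrix.mul_assoc]

/-! ### The standard nets -/

/-- The coefficients of the adjugate of the standard net of each type with respect to the
quadratic monomials at the positions `entries`. -/
def adjCoeff : NetType → Fin 4 → SymMat
  | .D => ![form 1 0 0 0 0 0, form 0 0 (-1) (-1) 0 0, form 0 1 0 0 0 0, form 0 0 1 0 0 0]
  | .F => ![form 0 0 0 0 (-1) 0, form (-1) (-1) 0 1 0 0, form 0 0 0 0 0 (-1), form 0 0 1 0 0 0]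
  | .Fstar => ![form 1 0 0 0 0 0, form 0 0 0 (-1) 0 0, form 0 1 1 0 0 0, form 0 0 (-1) 0 0 0]
  | .Gstar => ![form (-1) 0 0 0 0 0, form 0 0 0 0 1 0, form 0 0 0 0 0 (-1), form 0 0 (-1) 0 0 0]

theorem form_add (a b c p q r a' b' c' p' q' r' : ℂ) :
    form a b c p q r + form a' b' c' p' q' r' =
      form (a + a') (b + b') (c + c') (p + p') (q + q') (r + r') := by
  apply Subtype.ext
  ext i j
  fin_cases i <;> fin_cases j <;> rfl

theorem smul_form (x a b c p q r : ℂ) :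
    x • form a b c p q r = form (x * a) (x * b) (x * c) (x * p) (x * q) (x * r) := by
  apply Subtype.ext
  ext i j
  fin_cases i <;> fin_cases j <;> rfl

theorem form_eq_zero {a b c p q r : ℂ} :
    form a b c p q r = 0 ↔ a = 0 ∧ b = 0 ∧ c = 0 ∧ p = 0 ∧ q = 0 ∧ r = 0 := by
  constructor
  · intro h
    have h' : ∀ i j, (form a b c p q r).1 i j = 0 := fun i j => by rw [h]; rfl
    exact ⟨h' 0 0, h' 1 1, h' 2 2, h' 0 1, h' 0 2, h' 1 2⟩
  · rintro ⟨rfl, rfl, rfl, rfl, rfl, rfl⟩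
    apply Subtype.ext
    ext i j
    fin_cases i <;> fin_cases j <;> rfl

theorem eq_form (M : SymMat) :
    M = form (M.1 0 0) (M.1 1 1) (M.1 2 2) (M.1 0 1) (M.1 0 2) (M.1 1 2) := by
  have h : ∀ i j, M.1 i j = M.1 j i := fun i j => Matrix.IsSymm.apply M.2 j i
  apply Subtype.ext
  ext i j
  fin_cases i <;> fin_cases j <;> first | rfl | exact h _ _

theorem symAdj_form (a b c p q r : ℂ) :
    symAdj (form a b c p q r) = form (b * c - r * r) (a * c - q * q) (a * b - p * p)
      (q * r - p * c) (p * r - b * q) (p * q - a * r) := by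
  apply Subtype.ext
  change Matrix.adjugate !![a, p, q; p, b, r; q, r, c] = _
  rw [Matrix.adjugate_fin_three]
  ext i j
  fin_cases i <;> fin_cases j <;> simp [form] <;> ring

theorem linearIndependent_generators (τ : NetType) : LinearIndependent ℂ (generators τ) := by
  rw [Fintype.linearIndependent_iff]
  intro t ht
  cases τ <;>
  · simp [generators, Fin.sum_univ_three, smul_form, form_add, form_eq_zero] at ht
    intro i
    fin_cases i <;> simp [ht]

theorem linearIndependent_adjCoeff (τ : NetType) : LinearIndependent ℂ (adjCoeff τ) := by
  rw [Fintype.linearIndependent_iff]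
  intro t ht
  cases τ <;>
  · simp [adjCoeff, Fin.sum_univ_four, smul_form, form_add, form_eq_zero] at ht
    intro i
    fin_cases i <;> simp <;> grind

theorem symAdj_sum_generators (τ : NetType) (t : Fin 3 → ℂ) :
    symAdj (∑ i, t i • generators τ i) =
      ∑ k, (t (entries τ k).1 * t (entries τ k).2) • adjCoeff τ k := by
  cases τ <;>
  · simp only [generators, adjCoeff, entries, Fin.sum_univ_three, Fin.sum_univ_four, smul_form,
      form_add, symAdj_form, Matrix.cons_val]
    congr 1 <;> ring

theorem exists_det_ne_zero (τ : NetType) :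
    ∃ A ∈ Submodule.span ℂ (Set.range (generators τ)), A.1.det ≠ 0 := by
  refine ⟨generators τ 0 + generators τ 2, add_mem (Submodule.subset_span ⟨0, rfl⟩)
    (Submodule.subset_span ⟨2, rfl⟩), ?_⟩
  cases τ <;>
  · simp only [generators, Matrix.cons_val, form_add]
    simp [form, Matrix.det_fin_three]

/-- The linear map extending `t tᵀ ↦ adj (t₁ S₁ + t₂ S₂ + t₃ S₃)` for the standard generators. -/
def adjMap (τ : NetType) : SymMat →ₗ[ℂ] SymMat where
  toFun M := ∑ k, M.1 (entries τ k).1 (entries τ k).2 • adjCoeff τ k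
  map_add' M N := by simp [add_smul, Finset.sum_add_distrib]
  map_smul' c M := by simp [mul_smul, Finset.smul_sum]

theorem adjMap_veronese (τ : NetType) (t : Fin 3 → ℂ) :
    adjMap τ (veronese t) = symAdj (∑ i, t i • generators τ i) :=
  (symAdj_sum_generators τ t).symm

/-- The matrices `adjCoeff τ k` are independent, so all four coefficients must vanish. -/
theorem mem_ker_adjMap {τ : NetType} {M : SymMat} :
    M ∈ LinearMap.ker (adjMap τ) ↔ ∀ k, M.1 (entries τ k).1 (entries τ k).2 = 0 := by
  refine ⟨fun h => Fintype.linearIndependent_iff.1 (linearIndependent_adjCoeff τ) _ h, fun h => ?_⟩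
  simp [adjMap, h]

theorem veronese_single :
    veronese (Pi.single 0 1) = form 1 0 0 0 0 0 ∧ veronese (Pi.single 1 1) = form 0 1 0 0 0 0 ∧
      symPair (Pi.single 0 1) (Pi.single 1 1) = form 0 0 0 1 0 0 := by
  refine ⟨?_, ?_, ?_⟩ <;> apply Subtype.ext <;> ext i j <;>
    fin_cases i <;> fin_cases j <;>
    simp [symPair_apply, veronese, form, Matrix.vecMulVec_apply]

theorem ker_adjMap_of_secant {τ : NetType} (hτ : τ = .D ∨ τ = .F) :
    LinearMap.ker (adjMap τ) =
      Submodule.span ℂ {veronese (Pi.single 0 1), veronese (Pi.single 1 1)} := by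
  have he : entries τ = ![(1, 2), (2, 2), (0, 2), (0, 1)] := by
    rcases hτ with rfl | rfl <;> rfl
  ext M
  rw [mem_ker_adjMap, Submodule.mem_span_pair, he, veronese_single.1, veronese_single.2.1]
  simp only [smul_form, form_add]
  constructor
  · intro h
    refine ⟨M.1 0 0, M.1 1 1, ?_⟩
    have h0 := h 0
    have h1 := h 1
    have h2 := h 2
    have h3 := h 3
    simp only [Matrix.cons_val] at h0 h1 h2 h3
    conv_rhs => rw [eq_form M]
    simp [h0, h1, h2, h3]
  · rintro ⟨a, b, rfl⟩ k
    fin_cases k <;> simp [form]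

theorem ker_adjMap_of_tangent {τ : NetType} (hτ : τ = .Fstar ∨ τ = .Gstar) :
    LinearMap.ker (adjMap τ) =
      Submodule.span ℂ
        {veronese (Pi.single 0 1), symPair (Pi.single 0 1) (Pi.single 1 1)} := by
  have he : entries τ = ![(2, 2), (1, 2), (0, 2), (1, 1)] := by
    rcases hτ with rfl | rfl <;> rfl
  ext M
  rw [mem_ker_adjMap, Submodule.mem_span_pair, he, veronese_single.1, veronese_single.2.2]
  simp only [smul_form, form_add]
  constructor
  · intro h
    refine ⟨M.1 0 0, M.1 0 1, ?_⟩
    have h0 := h 0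
    have h1 := h 1
    have h2 := h 2
    have h3 := h 3
    simp only [Matrix.cons_val] at h0 h1 h2 h3
    conv_rhs => rw [eq_form M]
    simp [h0, h1, h2, h3]
  · rintro ⟨a, b, rfl⟩ k
    fin_cases k <;> simp [form]

theorem finrank_ker_adjMap (τ : NetType) : Module.finrank ℂ (LinearMap.ker (adjMap τ)) = 2 := by
  have key : ∀ A B : SymMat, LinearIndependent ℂ ![A, B] →
      Module.finrank ℂ (Submodule.span ℂ {A, B}) = 2 := by
    intro A B h
    have := finrank_span_eq_card h
    rwa [Matrix.range_cons, Matrix.range_cons, Matrix.range_empty, Set.union_empty,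
      Set.singleton_union, Fintype.card_fin] at this
  obtain ⟨h1, h2, h3⟩ := veronese_single
  rcases (by cases τ <;> simp : (τ = .D ∨ τ = .F) ∨ (τ = .Fstar ∨ τ = .Gstar)) with h | h
  · rw [ker_adjMap_of_secant h, h1, h2]
    apply key
    rw [LinearIndependent.pair_iff]
    intro s t
    simp [smul_form, form_add, form_eq_zero]
  · rw [ker_adjMap_of_tangent h, h1, h3]
    apply key
    rw [LinearIndependent.pair_iff]
    intro s t
    simp [smul_form, form_add, form_eq_zero]

/-! ### Nets of a given type -/

theorem IsOfType.exists_basis {τ : NetType} {L : Submodule ℂ SymMat} (hL : IsOfType L τ) :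
    ∃ (g : Matrix.GeneralLinearGroup (Fin 3) ℂ) (b : Module.Basis (Fin 3) ℂ L),
      ∀ i, (b i : SymMat) = congruence g (generators τ i) := by
  obtain ⟨g, rfl⟩ := hL
  have hli : LinearIndependent ℂ (congruence g ∘ generators τ) :=
    (linearIndependent_generators τ).map' _ (LinearMap.ker_eq_bot.2 (congruence_injective g))
  have hspan : Submodule.span ℂ (Set.range (congruence g ∘ generators τ)) =
      (Submodule.span ℂ (Set.range (generators τ))).map (congruence g) := by
    rw [Submodule.map_span, ← Set.range_comp]
  refine ⟨g, (Module.Basis.span hli).map (LinearEquiv.ofEq _ _ hspan), fun i => ?_⟩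
  rw [Module.Basis.map_apply, LinearEquiv.coe_ofEq_apply, Module.Basis.span_apply]
  rfl

theorem IsOfType.exists_det_ne_zero {τ : NetType} {L : Submodule ℂ SymMat} (hL : IsOfType L τ) :
    ∃ A ∈ L, A.1.det ≠ 0 := by
  obtain ⟨g, rfl⟩ := hL
  obtain ⟨A, hA, hdet⟩ := NetsOfConics.exists_det_ne_zero τ
  refine ⟨congruence g A, Submodule.mem_map_of_mem hA, ?_⟩
  change (g.1.transpose * A.1 * g.1).det ≠ 0
  have hg : g.1.det ≠ 0 := ((Matrix.isUnit_iff_isUnit_det _).1 g.isUnit).ne_zero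
  rw [Matrix.det_mul, Matrix.det_mul, Matrix.det_transpose]
  exact mul_ne_zero (mul_ne_zero hg hdet) hg

/-- The matrix of linear forms `∑ i, tᵢ bᵢ`. -/
def genericMatrix (S : Fin 3 → SymMat) : Matrix (Fin 3) (Fin 3) (MvPolynomial (Fin 3) ℂ) :=
  ∑ i, (X i : MvPolynomial (Fin 3) ℂ) • (S i).1.map C

theorem genericMatrix_map_eval (S : Fin 3 → SymMat) (t : Fin 3 → ℂ) :
    (eval t).mapMatrix (genericMatrix S) = (∑ i, t i • S i : SymMat).1 := by
  ext i j
  simp [genericMatrix, Matrix.sum_apply]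

theorem exists_polynomial_coord_symAdj (S : Fin 3 → SymMat) :
    ∃ q : Sym2 (Fin 3) → MvPolynomial (Fin 3) ℂ,
      ∀ t s, eval t (q s) = coord (symAdj (∑ i, t i • S i)) s := by
  have h : ∀ s, ∃ p : MvPolynomial (Fin 3) ℂ,
      ∀ t, eval t p = coord (symAdj (∑ i, t i • S i)) s := by
    intro s
    induction s with
    | _ i j =>
      refine ⟨(genericMatrix S).adjugate i j, fun t => ?_⟩
      change _ = ((∑ i, t i • S i : SymMat).1.adjugate) i j
      rw [← genericMatrix_map_eval, ← RingHom.map_adjugate]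
      rfl
  choose q hq using h
  exact ⟨q, fun t s => hq s t⟩

theorem eval_det_genericMatrix (S : Fin 3 → SymMat) (t : Fin 3 → ℂ) :
    eval t (genericMatrix S).det = (∑ i, t i • S i : SymMat).1.det := by
  rw [← genericMatrix_map_eval, RingHom.map_det]

theorem symAdj_ne_zero {A : SymMat} (hA : A.1.det ≠ 0) : symAdj A ≠ 0 := by
  intro h
  have h1 : A.1.adjugate = 0 := congrArg Subtype.val h
  have h2 := A.1.mul_adjugate
  rw [h1, Matrix.mul_zero] at h2
  have := congrFun (congrFun h2 0) 0
  simp at this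
  exact hA this.symm

theorem symInv_eq_smul_symAdj (A : SymMat) : symInv A = (A.1.det)⁻¹ • symAdj A := by
  apply Subtype.ext
  change A.1⁻¹ = (A.1.det)⁻¹ • A.1.adjugate
  rw [Matrix.inv_def, Ring.inverse_eq_inv']

/-- A net is the set of linear combinations of a basis. -/
theorem sum_repr_smul {L : Submodule ℂ SymMat} (b : Module.Basis (Fin 3) ℂ L) {A : SymMat}
    (hA : A ∈ L) : ∑ i, b.repr ⟨A, hA⟩ i • (b i : SymMat) = A := by
  have := congrArg L.subtype (b.sum_repr ⟨A, hA⟩)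
  simpa only [map_sum, map_smul, Submodule.subtype_apply] using this

/-- This determinant serves as the `h` of `mem_vanishingForms_iff_of_parametrization` for both
surfaces. -/
theorem det_genericMatrix_ne_zero {L : Submodule ℂ SymMat} (b : Module.Basis (Fin 3) ℂ L)
    (hL : ∃ A ∈ L, A.1.det ≠ 0) : (genericMatrix fun i => (b i : SymMat)).det ≠ 0 := by
  obtain ⟨A, hA, hdet⟩ := hL
  intro h
  have h2 := eval_det_genericMatrix (fun i => (b i : SymMat)) (b.repr ⟨A, hA⟩)
  rw [h, map_zero, sum_repr_smul b hA] at h2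
  exact hdet h2.symm

theorem sum_smul_mem {L : Submodule ℂ SymMat} (b : Module.Basis (Fin 3) ℂ L) (t : Fin 3 → ℂ) :
    ∑ i, t i • (b i : SymMat) ∈ L :=
  Submodule.sum_mem _ fun i _ => Submodule.smul_mem _ _ (b i).2

/-- The forms vanishing on the reciprocal surface of a net. -/
theorem mem_vanishingForms_reciprocalSurface {L : Submodule ℂ SymMat}
    (b : Module.Basis (Fin 3) ℂ L) (hL : ∃ A ∈ L, A.1.det ≠ 0)
    {q : Sym2 (Fin 3) → MvPolynomial (Fin 3) ℂ}
    (hq : ∀ t s, eval t (q s) = coord (symAdj (∑ i, t i • (b i : SymMat))) s)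
    {d : ℕ} (f : homogeneousSubmodule (Sym2 (Fin 3)) ℂ d) :
    f ∈ vanishingForms (reciprocalSurface L) d ↔ aeval q f.1 = 0 := by
  rw [reciprocalSurface, vanishingForms_zariskiClosure]
  have hmk : ∀ A : SymMat, A.1.det ≠ 0 → ∀ (h : symInv A ≠ 0) (h' : symAdj A ≠ 0),
      Projectivization.mk ℂ (symInv A) h = Projectivization.mk ℂ (symAdj A) h' := fun A _ h h' =>
    (Projectivization.mk_eq_mk_iff' ℂ _ _ h h').2 ⟨_, (symInv_eq_smul_symAdj A).symm⟩
  refine mem_vanishingForms_iff_of_parametrization hq (det_genericMatrix_ne_zero b hL) ?_ ?_ f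
  · rintro _ ⟨A, hA, hdet, h, rfl⟩
    refine ⟨b.repr ⟨A, hA⟩, ?_⟩
    rw [sum_repr_smul b hA]
    exact ⟨symAdj_ne_zero hdet, hmk A hdet h _⟩
  · intro t ht
    rw [eval_det_genericMatrix] at ht
    have h : symInv (∑ i, t i • (b i : SymMat)) ≠ 0 := by
      rw [symInv_eq_smul_symAdj]
      exact smul_ne_zero (inv_ne_zero ht) (symAdj_ne_zero ht)
    exact ⟨symAdj_ne_zero ht, _, sum_smul_mem b t, ht, h, (hmk _ ht h _).symm⟩

/-- The forms vanishing on a linear projection of the Veronese surface that is given by adjugates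
of a net. -/
theorem mem_vanishingForms_projectionImage {L : Submodule ℂ SymMat}
    (b : Module.Basis (Fin 3) ℂ L) (hL : ∃ A ∈ L, A.1.det ≠ 0)
    {q : Sym2 (Fin 3) → MvPolynomial (Fin 3) ℂ}
    (hq : ∀ t s, eval t (q s) = coord (symAdj (∑ i, t i • (b i : SymMat))) s)
    {T : SymMat →ₗ[ℂ] SymMat}
    (hT : ∀ t, T (veronese t) = symAdj (∑ i, t i • (b i : SymMat)))
    {d : ℕ} (f : homogeneousSubmodule (Sym2 (Fin 3)) ℂ d) :
    f ∈ vanishingForms (projectionImage T veroneseSurface) d ↔ aeval q f.1 = 0 := by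
  simp only [← hT] at hq
  -- Singular members with nonzero adjugate also contribute points here, unlike for the set of
  -- inverses; the forms are not affected.
  refine mem_vanishingForms_iff_of_parametrization hq (det_genericMatrix_ne_zero b hL) ?_ ?_ f
  · rintro _ ⟨M, hM, hTM, ⟨t, ht, hp⟩, rfl⟩
    obtain ⟨c, hc⟩ := (Projectivization.mk_eq_mk_iff' ℂ _ _ hM ht).1 hp
    have hF : T (veronese t) ≠ 0 := by
      intro h
      apply hTM
      rw [← hc, map_smul, h, smul_zero]
    exact ⟨t, hF, (Projectivization.mk_eq_mk_iff' ℂ _ _ hTM hF).2 ⟨c, by rw [← hc, map_smul]⟩⟩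
  · intro t ht
    rw [eval_det_genericMatrix] at ht
    have hF : T (veronese t) ≠ 0 := by
      rw [hT]
      exact symAdj_ne_zero ht
    have hv : veronese t ≠ 0 := by
      intro h
      rw [h, map_zero] at hF
      exact hF rfl
    exact ⟨hF, _, hv, hF, ⟨t, hv, rfl⟩, rfl⟩

theorem IsOfType.hasDimensionAndDegree {τ : NetType} {L : Submodule ℂ SymMat}
    (hL : IsOfType L τ) : HasDimensionAndDegree (reciprocalSurface L) 2 2 := by
  obtain ⟨g, b, hb⟩ := hL.exists_basis
  obtain ⟨G, hG⟩ := exists_symAdj_congruence g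
  have hli : LinearIndependent ℂ (congruence G ∘ adjCoeff τ) :=
    (linearIndependent_adjCoeff τ).map' _ (LinearMap.ker_eq_bot.2 (congruence_injective G))
  refine hasDimensionAndDegree_of_hilbertFunction fun d => ?_
  -- `congruence G` keeps the coefficient matrices independent, so the coordinates span the same
  -- space as the four monomials.
  rw [hilbertFunction_eq_finrank_span_pow (mem_vanishingForms_reciprocalSurface b
    hL.exists_det_ne_zero (q := fun s => ∑ k, coord ((congruence G ∘ adjCoeff τ) k) s • quadric τ k)
    fun t s => ?_), span_coord_eq_span hli, finrank_span_quadric_pow]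
  have h : symAdj (∑ i, t i • (b i : SymMat)) =
      ∑ k, (t (entries τ k).1 * t (entries τ k).2) • congruence G (adjCoeff τ k) := by
    simp only [hb, ← map_smul, ← map_sum, hG, symAdj_sum_generators]
  rw [h]
  change _ = coordLinear _ s
  rw [map_sum, map_sum, Finset.sum_apply]
  refine Finset.sum_congr rfl fun k _ => ?_
  rw [smul_eval, quadric, map_mul, eval_X, eval_X, map_smul, Pi.smul_apply, smul_eq_mul, mul_comm]
  rfl

/-- The transpose matches `congruence_veronese`: the change of parameters becomes `congruence Q` on
`t tᵀ`. -/
theorem exists_generalLinearGroup_of_bases {L : Submodule ℂ SymMat}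
    (b b' : Module.Basis (Fin 3) ℂ L) :
    ∃ Q : Matrix.GeneralLinearGroup (Fin 3) ℂ, ∀ t : Fin 3 → ℂ,
      ∑ i, t i • (b' i : SymMat) = ∑ i, (Q.1.transpose.mulVec t) i • (b i : SymMat) := by
  have hu : IsUnit (b.toMatrix b').transpose.det := by
    rw [Matrix.det_transpose]
    exact Matrix.isUnit_det_of_right_inverse (b.toMatrix_mul_toMatrix_flip b')
  refine ⟨Matrix.GeneralLinearGroup.mk'' _ hu, fun t => ?_⟩
  change _ = ∑ i, ((b.toMatrix b').transpose.transpose.mulVec t) i • (b i : SymMat)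
  have h : ∀ j, (b' j : SymMat) = ∑ i, b.toMatrix b' i j • (b i : SymMat) := fun j => by
    simpa only [map_sum, map_smul, Submodule.subtype_apply] using
      (congrArg L.subtype (b.sum_toMatrix_smul_self b' j)).symm
  simp only [h, Matrix.transpose_transpose, Matrix.mulVec, dotProduct, Finset.sum_smul,
    Finset.smul_sum, smul_smul]
  rw [Finset.sum_comm]
  simp only [mul_comm]

theorem isSecantLine_span_veronese {u v : Fin 3 → ℂ}
    (h : Module.finrank ℂ (Submodule.span ℂ {veronese u, veronese v}) = 2) :
    IsSecantLine veroneseSurface (Submodule.span ℂ {veronese u, veronese v}) := by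
  have hle : ∀ A : SymMat, Module.finrank ℂ (Submodule.span ℂ {A}) ≠ 2 := fun A h => by
    have := finrank_span_le_card (R := ℂ) ({A} : Set SymMat)
    simp [h] at this
  have hu : veronese u ≠ 0 := by
    intro h0
    rw [h0, Submodule.span_insert_zero] at h
    exact hle _ h
  have hv : veronese v ≠ 0 := by
    intro h0
    rw [h0, Set.pair_comm, Submodule.span_insert_zero] at h
    exact hle _ h
  refine ⟨_, ⟨u, hu, rfl⟩, _, ⟨v, hv, rfl⟩, fun hp => ?_, ?_⟩
  · have := congrArg Projectivization.submodule hp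
    rw [Projectivization.submodule_mk, Projectivization.submodule_mk] at this
    rw [Submodule.span_insert, this, sup_idem] at h
    exact hle _ h
  · rw [Projectivization.submodule_mk, Projectivization.submodule_mk, Submodule.span_insert]

theorem isTangentLine_span_symPair {u v : Fin 3 → ℂ}
    (h : Module.finrank ℂ (Submodule.span ℂ {veronese u, symPair u v}) = 2) :
    IsTangentLine veroneseSurface (Submodule.span ℂ {veronese u, symPair u v}) := by
  have hu : veronese u ≠ 0 := by
    intro h0
    rw [h0, Submodule.span_insert_zero] at h
    have := finrank_span_le_card (R := ℂ) ({symPair u v} : Set SymMat)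
    simp [h] at this
  refine ⟨h, veronese u, hu, ⟨u, hu, rfl⟩, Submodule.subset_span (Set.mem_insert _ _), ?_⟩
  intro M hM
  obtain ⟨a, c, rfl⟩ := Submodule.mem_span_pair.1 hM
  -- Since `symPair u u = 2 • veronese u`, half of `a` moves into the second argument.
  have h1 : a • veronese u + c • symPair u v = symPair u ((a / 2) • u + c • v) := by
    apply Subtype.ext
    ext i j
    change a * (u i * u j) + c * (symPair u v).1 i j = _
    rw [symPair_apply, symPair_apply]
    simp only [Pi.add_apply, Pi.smul_apply, smul_eq_mul]
    ring
  rw [h1]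
  exact symPair_mem_tangentSpace u _

end NetsOfConics

end

open NetsOfConics in
theorem proposition3p6 (τ : NetType) (L : Submodule ℂ SymMat) (hL : IsOfType L τ) :
    -- the reciprocal surface is a surface of degree 2
    HasDimensionAndDegree (reciprocalSurface L) 2 2 ∧
    -- for any basis of the net, the adjugate map of the net factors through the Veronese map and
    -- a linear map `T`; the reciprocal surface is the projection by `T` of the Veronese surface
    ∀ b : Module.Basis (Fin 3) ℂ L, ∃ T : SymMat →ₗ[ℂ] SymMat,
      (∀ t : Fin 3 → ℂ, T (veronese t) = symAdj (∑ i, t i • (b i : SymMat))) ∧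
      reciprocalSurface L = zariskiClosure (projectionImage T veroneseSurface) ∧
      -- the center `ℙ(ker T)` is a line, of the stated kind
      Module.finrank ℂ (LinearMap.ker T) = 2 ∧
      (τ = NetType.D ∨ τ = NetType.F → IsSecantLine veroneseSurface (LinearMap.ker T)) ∧
      (τ = NetType.Fstar ∨ τ = NetType.Gstar →
        IsTangentLine veroneseSurface (LinearMap.ker T)) := by
  refine ⟨hL.hasDimensionAndDegree, fun b => ?_⟩
  obtain ⟨g, b₀, hb₀⟩ := hL.exists_basis
  obtain ⟨G, hG⟩ := exists_symAdj_congruence g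
  obtain ⟨Q, hQ⟩ := exists_generalLinearGroup_of_bases b₀ b
  have hT : ∀ t : Fin 3 → ℂ, (congruence G ∘ₗ adjMap τ ∘ₗ congruence Q) (veronese t) =
      symAdj (∑ i, t i • (b i : SymMat)) := by
    intro t
    simp only [LinearMap.comp_apply, congruence_veronese, adjMap_veronese, ← hG, map_sum, map_smul,
      hQ, hb₀]
  -- `congruence G` is injective and does not affect the kernel. `congruence Q` moves it by a
  -- congruence, which maps `veronese` and `symPair` to themselves with new vectors, so secants stay
  -- secants and tangents stay tangents.
  have hker : LinearMap.ker (congruence G ∘ₗ adjMap τ ∘ₗ congruence Q) =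
      (LinearMap.ker (adjMap τ)).map (congruenceEquiv Q⁻¹ : SymMat →ₗ[ℂ] SymMat) := by
    rw [LinearMap.ker_comp_of_ker_eq_bot _ (LinearMap.ker_eq_bot.2 (congruence_injective G)),
      LinearMap.ker_comp]
    exact (Submodule.map_equiv_eq_comap_symm (congruenceEquiv Q⁻¹) _).symm
  have hrank : Module.finrank ℂ (LinearMap.ker (congruence G ∘ₗ adjMap τ ∘ₗ congruence Q)) = 2 := by
    rw [hker, LinearEquiv.finrank_map_eq, finrank_ker_adjMap]
  refine ⟨congruence G ∘ₗ adjMap τ ∘ₗ congruence Q, hT, ?_, hrank, fun h => ?_, fun h => ?_⟩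
  · obtain ⟨q, hq⟩ := exists_polynomial_coord_symAdj fun i => (b i : SymMat)
    apply zariskiClosure_congr
    intro d
    rw [← vanishingForms_zariskiClosure]
    ext1 f
    exact (mem_vanishingForms_reciprocalSurface b hL.exists_det_ne_zero hq f).trans
      (mem_vanishingForms_projectionImage b hL.exists_det_ne_zero hq hT f).symm
  · rw [hker, ker_adjMap_of_secant h, Submodule.map_span, Set.image_pair] at hrank ⊢
    change Module.finrank ℂ (Submodule.span ℂ {congruence _ _, congruence _ _}) = 2 at hrank
    change IsSecantLine _ (Submodule.span ℂ {congruence _ _, congruence _ _})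
    rw [congruence_veronese, congruence_veronese] at hrank ⊢
    exact isSecantLine_span_veronese hrank
  · rw [hker, ker_adjMap_of_tangent h, Submodule.map_span, Set.image_pair] at hrank ⊢
    change Module.finrank ℂ (Submodule.span ℂ {congruence _ _, congruence _ _}) = 2 at hrank
    change IsTangentLine _ (Submodule.span ℂ {congruence _ _, congruence _ _})
    rw [congruence_veronese, congruence_symPair] at hrank ⊢
    exact isTangentLine_span_symPair hrank
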